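/- Rings are associative with unity, not necessarily commutative. Let $R$ be a subring of a ring $A$ and let $x_1,\dots,x_n\in A$ ($n\ge 0$). Recall that $A$ is a skew PBW extension of $R$ (in $x_1,\dots,x_n$) if: (a) $A$ is a free left $R$-module with basis the monomials $x^{\alpha}=x_1^{\alpha_1}\cdots x_n^{\alpha_n}$, $\alpha\in\mathbb{N}^n$ (where $x^0=1$); (b) for every $1\le i\le n$ and every $r\in R\setminus\{0\}$ there is $c_{i,r}\in R\setminus\{0\}$ with $x_ir-c_{i,r}x_i\in R$; (c) for all $1\le i,j\le n$ there is $c_{i,j}\in R\setminus\{0\}$ with $x_jx_i-c_{i,j}x_ix_j\in R+Rx_1+\cdots+Rx_n$. In this case $R$ is called skew-Armendariz (with respect to $A$ and $x_1,\dots,x_n$) if, for all $f=\sum_{\alpha}a_{\alpha}x^{\alpha}$ and $g=\sum_{\beta}b_{\beta}x^{\beta}$ in $A$ (finite sums with $a_\alpha,b_\beta\in R$), $fg=0$ implies $a_0b_{\beta}=0$ for every $\beta\in\mathbb{N}^n$, where $a_0$ is the coefficient of $x^0=1$ in $f$. A ring $B$ is Baer if the right annihilator of every nonempty subset of $B$ has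 the form $eB$ for some idempotent $e\in B$. Theorem. Let $A$ be a skew PBW extension of a ring $R$. If $R$ is skew-Armendariz, then $R$ is a Baer ring if and only if $A$ is a Baer ring. -/

import Mathlib

/-- A ring `B` is a *Baer ring* if the right annihilator of every nonempty subset of `B` is
generated, as a right ideal, by an idempotent: it equals `eB` for some `e` with `e * e = e`. -/
def IsBaerRing (B : Type*) [Ring B] : Prop :=
  ∀ S : Set B, S.Nonempty →
    ∃ e : B, IsIdempotentElem e ∧
      {b : B | ∀ s ∈ S, s * b = 0} = Set.range (fun c : B => e * c)

namespace SkewPBW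

/-- The standard monomial `x^α = x₁^α₁ ⋯ xₙ^αₙ`, with the factors in this order. -/
def stdMonomial {A : Type*} [Ring A] {n : ℕ} (x : Fin n → A) (α : Fin n → ℕ) : A :=
  (List.ofFn fun i => x i ^ α i).prod

/-- The element `∑ a_α x^α` (a finite sum) of `A` with coefficients `a_α ∈ R` on the left. -/
noncomputable def ofCoeffs {A : Type*} [Ring A] (R : Subring A) {n : ℕ} (x : Fin n → A)
    (a : (Fin n → ℕ) →₀ R) : A :=
  a.sum fun α r => (r : A) * stdMonomial x α

/-- `A` is a skew PBW extension (`σ`-PBW extension) of its subring `R`, in the elements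
`x₁, …, xₙ` of `A`. In the first two fields `A` is a left `R`-module by multiplication. -/
structure IsSkewPBWExtension {A : Type*} [Ring A] (R : Subring A) {n : ℕ} (x : Fin n → A) :
    Prop where
  /-- The standard monomials are left linearly independent over `R`. -/
  linearIndependent : LinearIndependent R (stdMonomial x)
  /-- The standard monomials span `A` as a left `R`-module. -/
  span_eq_top : Submodule.span R (Set.range (stdMonomial x)) = ⊤
  /-- For `r ≠ 0` in `R` there is `c ≠ 0` in `R` with `xᵢ r - c xᵢ ∈ R`. -/
  var_mul_coeff : ∀ (i : Fin n) (r : R), r ≠ 0 →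
    ∃ c : R, c ≠ 0 ∧ x i * (r : A) - (c : A) * x i ∈ R
  /-- There is `c ≠ 0` in `R` with `xⱼ xᵢ - c xᵢ xⱼ ∈ R + R x₁ + ⋯ + R xₙ`. -/
  var_mul_var : ∀ i j : Fin n,
    ∃ c : R, c ≠ 0 ∧ ∃ (r₀ : R) (r : Fin n → R),
      x j * x i - (c : A) * x i * x j = (r₀ : A) + ∑ k, (r k : A) * x k

/-- `R` is skew-Armendariz with respect to the extension `A` in the elements `x₁, …, xₙ`: if the
product of `f = ∑ a_α x^α` and `g = ∑ b_β x^β` is zero, then the constant coefficient `a₀` of `f`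
satisfies `a₀ b_β = 0` for every coefficient `b_β` of `g`. -/
def IsSkewArmendariz {A : Type*} [Ring A] (R : Subring A) {n : ℕ} (x : Fin n → A) : Prop :=
  ∀ a b : (Fin n → ℕ) →₀ R, ofCoeffs R x a * ofCoeffs R x b = 0 →
    ∀ β : Fin n → ℕ, a 0 * b β = 0

end SkewPBW

/-!
Let `A` be a skew PBW extension of `R`, with `R` skew-Armendariz. Applying the Armendariz condition
to `e (1 - e) = 0` and `(1 - e) e = 0` shows that every idempotent `e` of `A` lies in `R`
(`IsSkewArmendariz.mem_of_isIdempotentElem`). If `A` is Baer, the idempotent that generates the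
annihilator in `A` of a subset of `R` therefore also generates its annihilator in `R`.

For the converse, assume that there is at least one variable; otherwise `A = R`. For an idempotent
`e` and any `y`, the element `e + e y (1 - e)` is again idempotent, so `e A (1 - e)` and
`(1 - e) A e` are contained in `R`, and comparing coefficients shows that `e` is central in `A`
(`IsSkewArmendariz.commute_of_isIdempotentElem`). If `R` is Baer, every coefficient thus has a
support that is a central idempotent, which makes `R` reduced. The central point is that `f g = 0`
then forces `a_α b_β = 0` for all coefficients of `f` and `g`
(`IsSkewPBWExtension.repr_mul_repr_eq_zero`): a leading-term computation gives one such pair, and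
cutting `f` and `g` by a central support and its complement allows induction on the number of terms.
Hence the annihilator of `S ⊆ A` consists of the `g` whose coefficients all annihilate the
coefficients of the elements of `S`, and it is generated by the same idempotent as the annihilator
in `R` of these coefficients.

Leading terms are computed with words in the variables, filtered by length. Modulo shorter words,
a word may be rearranged at the cost of a left factor from `R`, and rearranging back shows that this
factor is left invertible when the target is a sorted word.
-/

namespace SkewPBW

variable {A : Type*} [Ring A] {R : Subring A} {n : ℕ} {x : Fin n → A}

/-! ### Words in the variables and the degree filtration -/

/-- The product in `A` of the variables listed in the word `w`, in the order of `w`. -/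
def wordProd (x : Fin n → A) (w : List (Fin n)) : A := (w.map x).prod

@[simp] lemma wordProd_nil : wordProd x [] = 1 := by simp [wordProd]

@[simp] lemma wordProd_cons (i : Fin n) (w : List (Fin n)) :
    wordProd x (i :: w) = x i * wordProd x w := by simp [wordProd]

lemma wordProd_append (v w : List (Fin n)) :
    wordProd x (v ++ w) = wordProd x v * wordProd x w := by simp [wordProd]

/-- The nondecreasing word in which the letter `i` occurs `α i` times. -/
def sortedWord (α : Fin n → ℕ) : List (Fin n) :=
  (List.ofFn fun i => List.replicate (α i) i).flatten

lemma wordProd_sortedWord (α : Fin n → ℕ) : wordProd x (sortedWord α) = stdMonomial x α := by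
  simp [wordProd, sortedWord, stdMonomial, List.map_flatten, List.prod_flatten, List.map_ofFn,
    Function.comp_def]

lemma count_sortedWord (α : Fin n → ℕ) (j : Fin n) : (sortedWord α).count j = α j := by
  simp [sortedWord, List.count_flatten, List.map_ofFn, Function.comp_def, List.sum_ofFn,
    List.count_replicate]

lemma length_sortedWord (α : Fin n → ℕ) : (sortedWord α).length = ∑ i, α i := by
  simp [sortedWord, List.length_flatten, List.map_ofFn, Function.comp_def, List.sum_ofFn]

lemma perm_sortedWord_count (w : List (Fin n)) :
    w.Perm (sortedWord fun i => w.count i) := by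
  rw [List.perm_iff_count]
  intro j
  rw [count_sortedWord]

lemma stdMonomial_single (i : Fin n) : stdMonomial x (Pi.single i 1) = x i := by
  have h : (sortedWord (Pi.single i 1)).Perm [i] := by
    rw [List.perm_iff_count]
    intro j
    rw [count_sortedWord]
    by_cases hj : j = i
    · simp [hj]
    · rw [Pi.single_eq_of_ne hj, List.count_eq_zero_of_not_mem (by simpa using hj)]
  rw [← wordProd_sortedWord, List.perm_singleton.1 h]
  simp

lemma stdMonomial_zero : stdMonomial x 0 = 1 := by
  simp [stdMonomial]

/-- The left `R`-submodule of `A` spanned by the words of length less than `d`. -/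
def degreeLT (R : Subring A) (x : Fin n → A) (d : ℕ) : Submodule R A :=
  Submodule.span R (wordProd x '' {w | w.length < d})

lemma wordProd_mem_degreeLT {w : List (Fin n)} {d : ℕ} (h : w.length < d) :
    wordProd x w ∈ degreeLT R x d :=
  Submodule.subset_span ⟨w, h, rfl⟩

lemma degreeLT_mono {d e : ℕ} (h : d ≤ e) : degreeLT R x d ≤ degreeLT R x e :=
  Submodule.span_mono (Set.image_mono fun _ hw => lt_of_lt_of_le hw h)

lemma coe_mul_mem_degreeLT {d : ℕ} (r : R) {y : A} (hy : y ∈ degreeLT R x d) :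
    (r : A) * y ∈ degreeLT R x d :=
  Submodule.smul_mem _ r hy

lemma mul_wordProd_mem_degreeLT {d : ℕ} {y : A} (hy : y ∈ degreeLT R x d) (w : List (Fin n)) :
    y * wordProd x w ∈ degreeLT R x (d + w.length) := by
  induction hy using Submodule.span_induction with
  | mem y hy =>
    obtain ⟨v, hv, rfl⟩ := hy
    rw [← wordProd_append]
    apply wordProd_mem_degreeLT
    simpa using hv
  | zero => simp
  | add y z _ _ hy hz => rw [add_mul]; exact add_mem hy hz
  | smul r y _ hy => rw [smul_mul_assoc]; exact Submodule.smul_mem _ r hy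

lemma IsSkewPBWExtension.exists_var_mul_eq (hA : IsSkewPBWExtension R x) (i : Fin n) (r : R) :
    ∃ c d : R, (r ≠ 0 → c ≠ 0) ∧ x i * (r : A) = (c : A) * x i + d := by
  by_cases hr : r = 0
  · exact ⟨0, 0, fun h => (h hr).elim, by simp [hr]⟩
  · obtain ⟨c, hc, hd⟩ := hA.var_mul_coeff i r hr
    exact ⟨c, ⟨_, hd⟩, fun _ => hc, by simp⟩

lemma IsSkewPBWExtension.var_mul_mem_degreeLT (hA : IsSkewPBWExtension R x) (i : Fin n) {d : ℕ}
    {y : A} (hy : y ∈ degreeLT R x d) : x i * y ∈ degreeLT R x (d + 1) := by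
  induction hy using Submodule.span_induction with
  | mem y hy =>
    obtain ⟨v, hv, rfl⟩ := hy
    rw [← wordProd_cons]
    apply wordProd_mem_degreeLT
    simpa using hv
  | zero => simp
  | add y z _ _ hy hz => rw [mul_add]; exact add_mem hy hz
  | smul r y hy' hy =>
    obtain ⟨c, e, -, h⟩ := hA.exists_var_mul_eq i r
    rw [Subring.smul_def, smul_eq_mul, ← mul_assoc, h, add_mul, mul_assoc]
    exact add_mem (coe_mul_mem_degreeLT c hy)
      (coe_mul_mem_degreeLT e (degreeLT_mono d.le_succ hy'))

/-- Up to words of smaller length, a word is a left multiple of each of its rearrangements. -/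
lemma IsSkewPBWExtension.exists_sub_mem_of_perm (hA : IsSkewPBWExtension R x)
    {v w : List (Fin n)} (h : v.Perm w) :
    ∃ c : R, wordProd x v - (c : A) * wordProd x w ∈ degreeLT R x v.length := by
  induction h with
  | nil => exact ⟨1, by simp⟩
  | @cons i v w hp ih =>
    obtain ⟨c, hc⟩ := ih
    obtain ⟨c', e, -, h⟩ := hA.exists_var_mul_eq i c
    refine ⟨c', ?_⟩
    have key : wordProd x (i :: v) - (c' : A) * wordProd x (i :: w)
        = x i * (wordProd x v - (c : A) * wordProd x w) + (e : A) * wordProd x w := by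
      rw [wordProd_cons, wordProd_cons, mul_sub, ← mul_assoc (x i), h]
      noncomm_ring
    rw [key, List.length_cons]
    exact add_mem (hA.var_mul_mem_degreeLT i hc)
      (coe_mul_mem_degreeLT e (wordProd_mem_degreeLT (by simp [hp.length_eq])))
  | swap i j l =>
    obtain ⟨c, -, r₀, r, h⟩ := hA.var_mul_var i j
    refine ⟨c, ?_⟩
    have key : wordProd x (j :: i :: l) - (c : A) * wordProd x (i :: j :: l)
        = (r₀ : A) * wordProd x l + ∑ k, (r k : A) * wordProd x (k :: l) := by
      simp only [wordProd_cons]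
      have := congrArg (· * wordProd x l) h
      simp only [sub_mul, add_mul, Finset.sum_mul, mul_assoc] at this ⊢
      exact this
    rw [key]
    exact add_mem (coe_mul_mem_degreeLT _ (wordProd_mem_degreeLT (by simp)))
      (sum_mem fun k _ => coe_mul_mem_degreeLT _ (wordProd_mem_degreeLT (by simp)))
  | @trans u v w h₁ h₂ ih₁ ih₂ =>
    obtain ⟨c, hc⟩ := ih₁
    obtain ⟨c', hc'⟩ := ih₂
    refine ⟨c * c', ?_⟩
    rw [← h₁.length_eq] at hc'
    convert add_mem hc (coe_mul_mem_degreeLT c hc') using 1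
    push_cast
    noncomm_ring

/-- Up to words of smaller length, a coefficient moves across a word to a coefficient, and a
nonzero one to a nonzero one. -/
lemma IsSkewPBWExtension.exists_wordProd_mul_sub_mem (hA : IsSkewPBWExtension R x)
    (w : List (Fin n)) (t : R) :
    ∃ t' : R, (t ≠ 0 → t' ≠ 0) ∧
      wordProd x w * (t : A) - (t' : A) * wordProd x w ∈ degreeLT R x w.length := by
  induction w with
  | nil => exact ⟨t, id, by simp⟩
  | cons i w ih =>
    obtain ⟨t', ht, hm⟩ := ih
    obtain ⟨c, e, hc, h⟩ := hA.exists_var_mul_eq i t'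
    refine ⟨c, fun h0 => hc (ht h0), ?_⟩
    have key : wordProd x (i :: w) * (t : A) - (c : A) * wordProd x (i :: w)
        = x i * (wordProd x w * (t : A) - (t' : A) * wordProd x w)
          + (e : A) * wordProd x w := by
      rw [wordProd_cons, mul_sub, ← mul_assoc (x i) (t' : A), h]
      noncomm_ring
    rw [key, List.length_cons]
    exact add_mem (hA.var_mul_mem_degreeLT i hm)
      (coe_mul_mem_degreeLT e (wordProd_mem_degreeLT (by simp)))

/-! ### Coefficients and leading terms -/

/-- The basis of standard monomials of a skew PBW extension. -/
noncomputable def IsSkewPBWExtension.basis (hA : IsSkewPBWExtension R x) :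
    Module.Basis (Fin n → ℕ) R A :=
  Module.Basis.mk hA.linearIndependent hA.span_eq_top.ge

lemma IsSkewPBWExtension.basis_apply (hA : IsSkewPBWExtension R x) (α : Fin n → ℕ) :
    hA.basis α = stdMonomial x α := by
  simp [IsSkewPBWExtension.basis]

lemma IsSkewPBWExtension.coord_stdMonomial (hA : IsSkewPBWExtension R x) (γ α : Fin n → ℕ) :
    hA.basis.coord γ (stdMonomial x α) = if α = γ then 1 else 0 := by
  rw [← hA.basis_apply, Module.Basis.coord_apply, Module.Basis.repr_self, Finsupp.single_apply]

lemma coord_coe_mul {ι : Type*} (b : Module.Basis ι R A) (γ : ι) (r : R) (y : A) :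
    b.coord γ ((r : A) * y) = r * b.coord γ y :=
  (b.coord γ).map_smul r y

lemma IsSkewPBWExtension.ofCoeffs_repr (hA : IsSkewPBWExtension R x) (f : A) :
    ofCoeffs R x (hA.basis.repr f) = f := by
  conv_rhs => rw [← hA.basis.linearCombination_repr f]
  simp [ofCoeffs, Finsupp.linearCombination_apply, hA.basis_apply, Subring.smul_def]

lemma IsSkewPBWExtension.coord_eq_zero_of_mem_degreeLT (hA : IsSkewPBWExtension R x) {d : ℕ}
    {y : A} (hy : y ∈ degreeLT R x d) {γ : Fin n → ℕ} (hd : d ≤ ∑ i, γ i) :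
    hA.basis.coord γ y = 0 := by
  induction d generalizing y with
  | zero =>
    have : y = 0 := by simpa [degreeLT] using hy
    simp [this]
  | succ d ih =>
    induction hy using Submodule.span_induction with
    | mem y hy =>
      obtain ⟨w, hw, rfl⟩ := hy
      obtain ⟨c, hc⟩ := hA.exists_sub_mem_of_perm (perm_sortedWord_count w)
      have h1 := ih (degreeLT_mono (Nat.lt_succ_iff.1 hw) hc) (by omega)
      have hl := (perm_sortedWord_count w).length_eq
      rw [length_sortedWord] at hl
      rw [map_sub, coord_coe_mul, wordProd_sortedWord, hA.coord_stdMonomial, if_neg] at h1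
      · simpa using h1
      · rintro rfl
        have hw : w.length < d + 1 := hw
        exact absurd (hd.trans hl.ge) (Nat.not_le.2 hw)
    | zero => simp
    | add y z _ _ hy hz => rw [map_add, hy, hz, add_zero]
    | smul r y _ hy => rw [map_smul, hy, smul_zero]

lemma IsSkewPBWExtension.eq_zero_of_mul_stdMonomial_mem (hA : IsSkewPBWExtension R x)
    {r : R} {α : Fin n → ℕ} {d : ℕ} (h : (r : A) * stdMonomial x α ∈ degreeLT R x d)
    (hd : d ≤ ∑ i, α i) : r = 0 := by
  have := hA.coord_eq_zero_of_mem_degreeLT h hd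
  rwa [coord_coe_mul, hA.coord_stdMonomial, if_pos rfl, mul_one] at this

/-- Up to terms of lower degree, `x^α x^β` is a multiple of `x^(α+β)` by a left invertible
coefficient. The left inverse comes from rearranging the letters back. -/
lemma IsSkewPBWExtension.exists_stdMonomial_mul_sub_mem (hA : IsSkewPBWExtension R x)
    (α β : Fin n → ℕ) :
    ∃ c c' : R, c' * c = 1 ∧
      stdMonomial x α * stdMonomial x β - (c : A) * stdMonomial x (α + β) ∈
        degreeLT R x (∑ i, α i + ∑ i, β i) := by
  have hp : (sortedWord α ++ sortedWord β).Perm (sortedWord (α + β)) := by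
    rw [List.perm_iff_count]
    intro j
    simp [count_sortedWord]
  obtain ⟨c, hc⟩ := hA.exists_sub_mem_of_perm hp
  obtain ⟨c', hc'⟩ := hA.exists_sub_mem_of_perm hp.symm
  simp only [wordProd_append, wordProd_sortedWord, List.length_append, length_sortedWord] at hc hc'
  have hs : ∑ i, (α + β) i = ∑ i, α i + ∑ i, β i := by simp [Finset.sum_add_distrib]
  rw [hs] at hc'
  refine ⟨c, c', ?_, hc⟩
  have h := add_mem hc' (coe_mul_mem_degreeLT c' hc)
  have h1 : ((1 - c' * c : R) : A) * stdMonomial x (α + β) ∈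
      degreeLT R x (∑ i, α i + ∑ i, β i) := by
    convert h using 1
    push_cast
    noncomm_ring
  exact (sub_eq_zero.1 (hA.eq_zero_of_mul_stdMonomial_mem h1 hs.ge)).symm

/-! ### Idempotents -/

/-- Comparing coefficients in `e (1 - e) = 0 = (1 - e) e` forces `e` to be constant. -/
lemma IsSkewArmendariz.mem_of_isIdempotentElem (hR : IsSkewArmendariz R x)
    (hA : IsSkewPBWExtension R x) {e : A} (he : IsIdempotentElem e) : e ∈ R := by
  have h1 := hR (hA.basis.repr e) (hA.basis.repr (1 - e)) (by
    rw [hA.ofCoeffs_repr, hA.ofCoeffs_repr, he.mul_one_sub_self])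
  have h2 := hR (hA.basis.repr (1 - e)) (hA.basis.repr e) (by
    rw [hA.ofCoeffs_repr, hA.ofCoeffs_repr, he.one_sub_mul_self])
  have hone : hA.basis.repr (1 : A) = Finsupp.single 0 1 := by
    rw [← hA.basis.repr_self, hA.basis_apply, stdMonomial_zero]
  have h3 : hA.basis.repr e = Finsupp.single 0 (hA.basis.repr e 0) := by
    ext1 β
    by_cases hβ : β = 0
    · simp [hβ]
    · have h1 := h1 β
      have h2 := h2 β
      rw [map_sub, hone] at h1 h2
      simp only [Finsupp.sub_apply, Finsupp.single_eq_same, Finsupp.single_apply,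
        if_neg (Ne.symm hβ), zero_sub, mul_neg, neg_eq_zero, sub_mul, one_mul] at h1 h2 ⊢
      rw [h1, sub_zero] at h2
      exact h2
  rw [← hA.ofCoeffs_repr e, h3]
  simp [ofCoeffs, stdMonomial_zero]

lemma IsSkewPBWExtension.eq_zero_of_mul_var_mem (hA : IsSkewPBWExtension R x) {i : Fin n} {r : R}
    (h : (r : A) * x i ∈ R) : r = 0 := by
  apply hA.eq_zero_of_mul_stdMonomial_mem (α := Pi.single i 1) (d := 1) _ (by simp)
  rw [stdMonomial_single]
  have := coe_mul_mem_degreeLT (R := R) (x := x) ⟨_, h⟩ (wordProd_mem_degreeLT (w := []) one_pos)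
  simpa using this

lemma _root_.IsIdempotentElem.add_mul_mul_one_sub {B : Type*} [Ring B] {e : B}
    (he : IsIdempotentElem e) (y : B) : IsIdempotentElem (e + e * y * (1 - e)) := by
  have h1 : (1 - e) * e = 0 := he.one_sub_mul_self
  have he' : e * e = e := he
  calc (e + e * y * (1 - e)) * (e + e * y * (1 - e))
      = e * e + e * e * y * (1 - e) + e * y * ((1 - e) * e)
        + e * y * ((1 - e) * e) * y * (1 - e) := by noncomm_ring
    _ = e + e * y * (1 - e) := by rw [h1, he']; simp

lemma IsSkewArmendariz.mul_mul_one_sub_mem (hR : IsSkewArmendariz R x)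
    (hA : IsSkewPBWExtension R x) {e : A} (he : IsIdempotentElem e) (y : A) :
    e * y * (1 - e) ∈ R := by
  simpa using sub_mem (hR.mem_of_isIdempotentElem hA (he.add_mul_mul_one_sub y))
    (hR.mem_of_isIdempotentElem hA he)

/-- If there is at least one variable, all idempotents are central: the elements `e y (1 - e)`
and `(1 - e) y e` lie in `R`, and taking `y = r xᵢ` this forces `e` to commute with `r` and
with `xᵢ`. -/
lemma IsSkewArmendariz.commute_of_isIdempotentElem [Nonempty (Fin n)]
    (hR : IsSkewArmendariz R x) (hA : IsSkewPBWExtension R x) {e : A}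
    (he : IsIdempotentElem e) (y : A) : Commute e y := by
  obtain ⟨e, rfl⟩ : ∃ e' : R, (e' : A) = e := ⟨⟨e, hR.mem_of_isIdempotentElem hA he⟩, rfl⟩
  have hee : e * e = e := Subtype.ext he
  have hmem := hR.mul_mul_one_sub_mem hA he
  have hmem' : ∀ y : A, (1 - (e : A)) * y * e ∈ R := fun y => by
    simpa using hR.mul_mul_one_sub_mem hA he.one_sub y
  have hvar : ∀ i, ∃ d : R, x i * (e : A) = (e : A) * x i + d := fun i => by
    obtain ⟨c, d, -, h⟩ := hA.exists_var_mul_eq i e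
    have h1 : e - e * c = 0 := by
      apply hA.eq_zero_of_mul_var_mem (i := i)
      have h2 := add_mem (hmem (x i)) (e * d).2
      convert h2 using 1
      rw [mul_sub, mul_assoc _ (x i) (e : A), h]
      push_cast
      noncomm_ring
    have h2 : c - e * c = 0 := by
      apply hA.eq_zero_of_mul_var_mem (i := i)
      have h2 := sub_mem (hmem' (x i)) ((1 - e) * d).2
      convert h2 using 1
      rw [mul_assoc _ (x i) (e : A), h]
      push_cast
      noncomm_ring
    have hc : c = e := (sub_eq_zero.1 h2).trans (sub_eq_zero.1 h1).symm
    exact ⟨d, by rw [h, hc]⟩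
  have hcoe : ∀ r : R, e * r = r * e := fun r => by
    obtain ⟨i⟩ := ‹Nonempty (Fin n)›
    obtain ⟨d, h⟩ := hvar i
    have h1 : e * r * (1 - e) = 0 := by
      apply hA.eq_zero_of_mul_var_mem (i := i)
      have h2 := add_mem (hmem (r * x i)) (e * r * d).2
      convert h2 using 1
      have : (e : A) * (r * x i) * (1 - e) = e * r * x i - e * r * (x i * e) := by noncomm_ring
      rw [this, h]
      push_cast
      noncomm_ring
    have h2 : (1 - e) * r * e = 0 := by
      apply hA.eq_zero_of_mul_var_mem (i := i)
      have h2 := sub_mem (hmem' (r * x i)) ((1 - e) * r * d).2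
      convert h2 using 1
      have : (1 - (e : A)) * (r * x i) * e = (1 - (e : A)) * r * (x i * e) := by noncomm_ring
      rw [this, h]
      push_cast
      noncomm_ring
    rw [mul_sub, mul_one, sub_eq_zero] at h1
    rw [sub_mul, one_mul, sub_mul, sub_eq_zero] at h2
    rw [h1, h2]
  have hcx : ∀ i, Commute (e : A) (x i) := fun i => by
    obtain ⟨d, h⟩ := hvar i
    have h1 : (d : A) = e * d + d * e := by
      have h2 : x i * (e : A) * e = x i * e := by rw [mul_assoc, he.eq]
      rw [h, add_mul, mul_assoc, h, mul_add, ← mul_assoc, he.eq, add_assoc] at h2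
      exact (add_left_cancel h2).symm
    have h3 : d = e * d + d * e := Subtype.ext h1
    have h4 : e * d = 0 := by
      have := congrArg (e * ·) h3
      simp only [mul_add, ← mul_assoc, hee] at this
      rw [mul_assoc, ← hcoe d, ← mul_assoc, hee] at this
      simpa using this
    rw [← hcoe d, h4, add_zero] at h3
    rw [h3] at h
    simpa [Commute, SemiconjBy] using h.symm
  have hy : y ∈ Submodule.span R (Set.range (stdMonomial x)) := hA.span_eq_top ▸ trivial
  induction hy using Submodule.span_induction with
  | mem y hy =>
    obtain ⟨α, rfl⟩ := hy
    apply Commute.list_prod_right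
    intro z hz
    obtain ⟨i, rfl⟩ := (List.mem_ofFn' _ _).1 hz
    exact (hcx i).pow_right _
  | zero => exact Commute.zero_right _
  | add y z _ _ hy hz => exact hy.add_right hz
  | smul r y _ hy =>
    have hr : Commute (e : A) (r : A) := congrArg Subtype.val (hcoe r)
    exact hr.mul_right hy

/-! ### Central supports -/

/-- Every coefficient `a` has a support: an idempotent `s` of `R`, central in `A`, such that
`a s = a` and `s` kills whatever `a` kills on the right. -/
def HasCentralSupports (R : Subring A) : Prop :=
  ∀ a : R, ∃ s : R, IsIdempotentElem s ∧ (∀ y : A, Commute (s : A) y) ∧ a * s = a ∧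
    ∀ r : R, a * r = 0 → s * r = 0

lemma _root_.IsBaerRing.hasCentralSupports (hB : IsBaerRing R)
    (hc : ∀ e : A, IsIdempotentElem e → ∀ y, Commute e y) : HasCentralSupports R := by
  intro a
  obtain ⟨e, he, h⟩ := hB {a} (Set.singleton_nonempty a)
  have hmem : ∀ b : R, a * b = 0 ↔ ∃ c, e * c = b := fun b => by
    simpa using Set.ext_iff.1 h b
  refine ⟨1 - e, he.one_sub, fun y => ?_, ?_, fun r hr => ?_⟩
  · exact hc _ (congrArg Subtype.val he.one_sub.eq) y
  · rw [mul_sub, (hmem e).2 ⟨1, mul_one e⟩]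
    simp
  · obtain ⟨c, rfl⟩ := (hmem r).1 hr
    rw [← mul_assoc, he.one_sub_mul_self, zero_mul]

lemma HasCentralSupports.eq_zero_of_mul_self (hs : HasCentralSupports R) {a : R}
    (h : a * a = 0) : a = 0 := by
  obtain ⟨s, -, hc, has, hk⟩ := hs a
  rw [← has, show a * s = s * a from Subtype.ext (hc a).symm.eq, hk a h]

lemma HasCentralSupports.mul_eq_zero_symm (hs : HasCentralSupports R) {a b : R}
    (h : a * b = 0) : b * a = 0 := by
  apply hs.eq_zero_of_mul_self
  rw [mul_assoc, ← mul_assoc a, h, zero_mul, mul_zero]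

/-- The product of two terms has leading monomial `x^(α+β)`, and its leading coefficient vanishes
only if the product of the two coefficients does. -/
lemma IsSkewPBWExtension.exists_term_mul_term_sub_mem (hA : IsSkewPBWExtension R x)
    (hs : HasCentralSupports R) (a b : R) (α β : Fin n → ℕ) :
    ∃ k : R, (k = 0 → a * b = 0) ∧
      (a : A) * stdMonomial x α * (b * stdMonomial x β) - (k : A) * stdMonomial x (α + β) ∈
        degreeLT R x (∑ i, α i + ∑ i, β i) := by
  obtain ⟨b', -, hb⟩ := hA.exists_wordProd_mul_sub_mem (sortedWord α) b
  rw [wordProd_sortedWord, length_sortedWord] at hb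
  obtain ⟨c, c', hcc, hc⟩ := hA.exists_stdMonomial_mul_sub_mem α β
  refine ⟨a * b' * c, fun h0 => ?_, ?_⟩
  · have hab : a * b' = 0 := by
      have h1 := hs.mul_eq_zero_symm h0
      calc a * b' = c' * c * (a * b') := by rw [hcc, one_mul]
        _ = 0 := by rw [mul_assoc, h1, mul_zero]
    obtain ⟨s, -, hsc, has, hk⟩ := hs a
    have hsb : s * b' = 0 := hk _ hab
    -- Since `s` is central and `s b' = 0`, the product `x^α (s b)` has no term of degree `|α|`.
    have hlow : stdMonomial x α * ((s * b : R) : A) ∈ degreeLT R x (∑ i, α i) := by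
      have h1 := coe_mul_mem_degreeLT s hb
      rw [mul_sub, ← mul_assoc, ← mul_assoc, (hsc _).eq, ← Subring.coe_mul, hsb] at h1
      simpa [mul_assoc] using h1
    obtain ⟨t, ht, htm⟩ := hA.exists_wordProd_mul_sub_mem (sortedWord α) (s * b)
    rw [wordProd_sortedWord, length_sortedWord] at htm
    have h2 : (t : A) * stdMonomial x α ∈ degreeLT R x (∑ i, α i) := by
      simpa using sub_mem hlow htm
    have h3 : s * b = 0 := by
      by_contra hne
      exact ht hne (hA.eq_zero_of_mul_stdMonomial_mem h2 le_rfl)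
    rw [← has, mul_assoc, h3, mul_zero]
  · have h1 := mul_wordProd_mem_degreeLT (coe_mul_mem_degreeLT a hb) (sortedWord β)
    rw [wordProd_sortedWord, length_sortedWord] at h1
    have h2 := coe_mul_mem_degreeLT (a * b') hc
    convert add_mem h1 h2 using 1
    push_cast
    noncomm_ring

/-! ### Annihilators -/

lemma IsSkewPBWExtension.repr_coe_mul (hA : IsSkewPBWExtension R x) (r : R) (f : A) :
    hA.basis.repr ((r : A) * f) = r • hA.basis.repr f :=
  hA.basis.repr.map_smul r f

/-- Among the exponents of top total degree of `f` and `g` there are `α` and `β` whose sum is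
attained by no other such pair, since `ℕⁿ` has unique sums. The coefficient of `f g` at `α + β` is
then the leading coefficient of a single product of terms. -/
lemma IsSkewPBWExtension.exists_mul_repr_eq_zero (hA : IsSkewPBWExtension R x)
    (hs : HasCentralSupports R) {f g : A} (hf : f ≠ 0) (hg : g ≠ 0) (h : f * g = 0) :
    ∃ α ∈ (hA.basis.repr f).support, ∃ β ∈ (hA.basis.repr g).support,
      hA.basis.repr f α * hA.basis.repr g β = 0 := by
  set a := hA.basis.repr f with ha
  set b := hA.basis.repr g with hb
  have ha0 : a.support.Nonempty := by simpa [ha] using hf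
  have hb0 : b.support.Nonempty := by simpa [hb] using hg
  let deg : (Fin n → ℕ) → ℕ := fun α => ∑ i, α i
  have htop : ∀ t : Finset (Fin n → ℕ), t.Nonempty →
      ∃ u ⊆ t, u.Nonempty ∧ ∀ α ∈ t, ∀ β ∈ u, deg α ≤ deg β ∧ (α ∉ u → deg α < deg β) := by
    intro t ht
    obtain ⟨m, hm, hmax⟩ := t.exists_max_image deg ht
    refine ⟨t.filter fun α => deg α = deg m, Finset.filter_subset _ _,
      ⟨m, by simp [hm]⟩, fun α hα β hβ => ?_⟩
    simp only [Finset.mem_filter] at hβ ⊢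
    have := hmax α hα
    refine ⟨by omega, fun hn => ?_⟩
    have : deg α ≠ deg m := fun h => hn ⟨hα, h⟩
    omega
  obtain ⟨u, hu, hu0, hut⟩ := htop _ ha0
  obtain ⟨v, hv, hv0, hvt⟩ := htop _ hb0
  obtain ⟨α₀, hα₀, β₀, hβ₀, huniq⟩ := UniqueSums.uniqueAdd_of_nonempty hu0 hv0
  refine ⟨α₀, hu hα₀, β₀, hv hβ₀, ?_⟩
  choose k hk hkm using fun α β => hA.exists_term_mul_term_sub_mem hs (a α) (b β) α β
  have hdeg : ∀ α β : Fin n → ℕ, ∑ i, (α + β) i = deg α + deg β := fun α β => by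
    simp [deg, Finset.sum_add_distrib]
  have hterm : ∀ α ∈ a.support, ∀ β ∈ b.support,
      hA.basis.coord (α₀ + β₀) ((a α : A) * stdMonomial x α * (b β * stdMonomial x β)) =
        if α = α₀ ∧ β = β₀ then k α₀ β₀ else 0 := by
    intro α hα β hβ
    have h1 := hA.coord_eq_zero_of_mem_degreeLT (hkm α β) (γ := α₀ + β₀) (by
      rw [hdeg]
      exact add_le_add (hut α hα α₀ hα₀).1 (hvt β hβ β₀ hβ₀).1)
    rw [map_sub, coord_coe_mul, hA.coord_stdMonomial, sub_eq_zero] at h1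
    rw [h1]
    by_cases hαβ : α = α₀ ∧ β = β₀
    · rw [if_pos hαβ, hαβ.1, hαβ.2, if_pos rfl, mul_one]
    · rw [if_neg hαβ, if_neg, mul_zero]
      intro hsum
      have h2 := hdeg α β
      rw [hsum, hdeg] at h2
      obtain ⟨p1, p2⟩ := hut α hα α₀ hα₀
      obtain ⟨q1, q2⟩ := hvt β hβ β₀ hβ₀
      have hαu : α ∈ u := by
        by_contra hn
        have := p2 hn
        omega
      have hβv : β ∈ v := by
        by_contra hn
        have := q2 hn
        omega
      exact hαβ (huniq hαu hβv hsum)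
  apply hk
  have hfg : f * g = ∑ α ∈ a.support, ∑ β ∈ b.support,
      (a α : A) * stdMonomial x α * (b β * stdMonomial x β) := by
    rw [← Finset.sum_mul_sum]
    exact congrArg₂ _ (hA.ofCoeffs_repr f).symm (hA.ofCoeffs_repr g).symm
  have h0 := congrArg (hA.basis.coord (α₀ + β₀)) (hfg.symm.trans h)
  rw [map_zero, map_sum] at h0
  rw [← h0, Finset.sum_eq_single_of_mem α₀ (hu hα₀), map_sum,
    Finset.sum_eq_single_of_mem β₀ (hv hβ₀), hterm _ (hu hα₀) _ (hv hβ₀), if_pos ⟨rfl, rfl⟩]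
  · intro β hβ hne
    rw [hterm _ (hu hα₀) _ hβ, if_neg fun h => hne h.2]
  · intro α hα hne
    rw [map_sum]
    exact Finset.sum_eq_zero fun β hβ => by rw [hterm _ hα _ hβ, if_neg fun h => hne h.1]

/-- If `f g = 0`, then every coefficient of `f` kills every coefficient of `g`. With `s` the
support of a coefficient `a_α` that kills some `b_β`, both `s g` and `(1 - s) f` have fewer
terms than `g` and `f`. -/
lemma IsSkewPBWExtension.repr_mul_repr_eq_zero (hA : IsSkewPBWExtension R x)
    (hs : HasCentralSupports R) {f g : A} (h : f * g = 0) (α β : Fin n → ℕ) :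
    hA.basis.repr f α * hA.basis.repr g β = 0 := by
  induction hN : (hA.basis.repr f).support.card + (hA.basis.repr g).support.card
    using Nat.strong_induction_on generalizing f g with
  | _ N ih =>
  subst hN
  by_cases hf : f = 0
  · simp [hf]
  by_cases hg : g = 0
  · simp [hg]
  have hlt : ∀ (f : A) (r : R) (γ : Fin n → ℕ), γ ∈ (hA.basis.repr f).support →
      r * hA.basis.repr f γ = 0 →
      (hA.basis.repr ((r : A) * f)).support.card < (hA.basis.repr f).support.card := by
    intro f r γ hγ h0
    rw [hA.repr_coe_mul]
    refine Finset.card_lt_card ((Finset.ssubset_iff_of_subset Finsupp.support_smul).2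
      ⟨γ, hγ, ?_⟩)
    simpa using h0
  obtain ⟨α₀, hα₀, β₀, hβ₀, h0⟩ := hA.exists_mul_repr_eq_zero hs hf hg h
  obtain ⟨s, -, hsc, has, hk⟩ := hs (hA.basis.repr f α₀)
  have hscR : ∀ r : R, s * r = r * s := fun r => Subtype.ext (hsc r).eq
  have h1 := ih _ (Nat.add_lt_add_left (hlt g s β₀ hβ₀ (hk _ h0)) _)
    (f := f) (g := s * g) (by rw [← mul_assoc, ← (hsc f).eq, mul_assoc, h, mul_zero]) rfl
  have h2 := ih _ (Nat.add_lt_add_right (hlt f (1 - s) α₀ hα₀ (by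
      rw [sub_mul, one_mul, hscR, has, sub_self])) _)
    (f := ((1 - s : R) : A) * f) (g := g) (by rw [mul_assoc, h, mul_zero]) rfl
  rw [hA.repr_coe_mul, Finsupp.smul_apply, smul_eq_mul] at h1 h2
  rw [← mul_assoc, ← hscR, mul_assoc] at h1
  rwa [sub_mul, one_mul, sub_mul, mul_assoc, h1, sub_zero] at h2

/-! ### Baer rings -/

lemma IsSkewArmendariz.isBaerRing_subring (hR : IsSkewArmendariz R x)
    (hA : IsSkewPBWExtension R x) (hB : IsBaerRing A) : IsBaerRing R := by
  intro S hS
  obtain ⟨e, he, h⟩ := hB ((↑) '' S : Set A) (hS.image _)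
  obtain ⟨e, rfl⟩ : ∃ e' : R, (e' : A) = e := ⟨⟨e, hR.mem_of_isIdempotentElem hA he⟩, rfl⟩
  have hmem : ∀ b : A, (∀ s ∈ S, (s : A) * b = 0) ↔ ∃ c, (e : A) * c = b := fun b => by
    simpa using Set.ext_iff.1 h b
  refine ⟨e, Subtype.ext he, Set.ext fun b => ⟨fun hb => ?_, ?_⟩⟩
  · obtain ⟨c, hc⟩ := (hmem b).1 fun s hs => congrArg Subtype.val (hb s hs)
    refine ⟨b, Subtype.ext ?_⟩
    simp only [Subring.coe_mul]
    rw [← hc, ← mul_assoc, he.eq]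
  · rintro ⟨c, rfl⟩ s hs
    exact Subtype.ext ((hmem (e * c)).2 ⟨c, rfl⟩ s hs)

lemma IsSkewPBWExtension.isBaerRing_of_hasCentralSupports (hA : IsSkewPBWExtension R x)
    (hc : ∀ e : A, IsIdempotentElem e → ∀ y, Commute e y) (hB : IsBaerRing R) :
    IsBaerRing A := by
  have hs := hB.hasCentralSupports hc
  rintro S ⟨f₀, hf₀⟩
  obtain ⟨e, he, h⟩ := hB {a | ∃ f ∈ S, ∃ α, hA.basis.repr f α = a}
    ⟨_, f₀, hf₀, 0, rfl⟩
  have hmem : ∀ b : R, (∀ f ∈ S, ∀ α, hA.basis.repr f α * b = 0) ↔ ∃ c, e * c = b := fun b => by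
    rw [← Set.mem_range, ← h]
    exact ⟨fun hb a ⟨f, hf, α, hα⟩ => hα ▸ hb f hf α, fun hb f hf α => hb _ ⟨f, hf, α, rfl⟩⟩
  have heA : IsIdempotentElem (e : A) := congrArg Subtype.val he.eq
  refine ⟨e, heA, Set.ext fun g => ⟨fun hg => ⟨g, ?_⟩, ?_⟩⟩
  · apply hA.basis.repr.injective
    ext1 β
    simp only [hA.repr_coe_mul, Finsupp.smul_apply, smul_eq_mul]
    obtain ⟨c, hc⟩ := (hmem (hA.basis.repr g β)).1 fun f hf α =>
      hA.repr_mul_repr_eq_zero hs (hg f hf) α β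
    rw [← hc, ← mul_assoc, he.eq]
  · rintro ⟨c, rfl⟩ f hf
    have hef : (e : A) * f = 0 := by
      apply hA.basis.repr.injective
      ext1 α
      simp only [hA.repr_coe_mul, Finsupp.smul_apply, smul_eq_mul, map_zero, Finsupp.zero_apply]
      exact hs.mul_eq_zero_symm ((hmem e).2 ⟨1, mul_one e⟩ f hf α)
    simp only
    rw [← mul_assoc, ← (hc e heA f).eq, hef, zero_mul]

/-- Without variables `A = R`, and idempotents need not be central. -/
lemma IsSkewPBWExtension.isBaerRing_of_isEmpty [IsEmpty (Fin n)] (hA : IsSkewPBWExtension R x)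
    (hB : IsBaerRing R) : IsBaerRing A := by
  have hmem : ∀ y : A, y ∈ R := fun y => by
    rw [← hA.ofCoeffs_repr y]
    refine sum_mem fun α _ => mul_mem (Subtype.prop _) ?_
    rw [Subsingleton.elim α 0, stdMonomial_zero]
    exact one_mem R
  rintro S hS
  obtain ⟨s₀, hs₀⟩ := hS
  obtain ⟨e, he, h⟩ := hB {r : R | (r : A) ∈ S} ⟨⟨s₀, hmem s₀⟩, hs₀⟩
  refine ⟨e, congrArg Subtype.val he.eq, Set.ext fun b => ⟨fun hb => ?_, ?_⟩⟩
  · obtain ⟨c, hc⟩ := (Set.ext_iff.1 h ⟨b, hmem b⟩).1 fun s hs => Subtype.ext (hb s hs)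
    exact ⟨c, congrArg Subtype.val hc⟩
  · rintro ⟨c, rfl⟩ s hs
    exact congrArg Subtype.val
      ((Set.ext_iff.1 h (e * ⟨c, hmem c⟩)).2 ⟨⟨c, hmem c⟩, rfl⟩ ⟨s, hmem s⟩ hs)

end SkewPBW

theorem mainTheorem2 {A : Type*} [Ring A] (R : Subring A) {n : ℕ} (x : Fin n → A)
    (hA : SkewPBW.IsSkewPBWExtension R x) (hR : SkewPBW.IsSkewArmendariz R x) :
    IsBaerRing R ↔ IsBaerRing A := by
  refine ⟨fun hB => ?_, hR.isBaerRing_subring hA⟩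
  cases isEmpty_or_nonempty (Fin n)
  · exact hA.isBaerRing_of_isEmpty hB
  · exact hA.isBaerRing_of_hasCentralSupports
      (fun _ he => hR.commute_of_isIdempotentElem hA he) hB
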